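/- Let $N,M\ge 1$ be integers. Let $G_0$ be a finite deterministic multigraph without loops, each of whose edges has one of the types $1,\dots,N$, with at least one edge of each type. For $n\ge 1$ let $F_n=(\varepsilon^{(n)}_{k,l})_{k,l=1}^N$ be a deterministic matrix with entries in $[0,1]$ and all row sums equal to $1$, and suppose that $F_n\to F=(\varepsilon_{k,l})_{k,l=1}^N$ entrywise, where $F$ also has all row sums equal to $1$. The perturbed Barabási–Albert random graph $(G_n)_{n\ge 0}$ is the following growing sequence of random multigraphs with typed edges. In step $n\ge1$ a new vertex is added and joined by $M$ new edges (possibly parallel) to vertices of $G_{n-1}$. Conditionally on $G_0,\dots,G_{n-1}$, the $M$ new edges are treated independently, each as follows: its old endpoint is a vertex $v$ of $G_{n-1}$ chosen with probability proportional to the degree of $v$ in $G_{n-1}$; it gets a first type $k$ with probability equal to the proportion of type $k$ edges among the edges of $G_{n-1}$ at $v$; and then its type becomes $l$ with probability $\varepsilon^{(n)}_{k,l}$. Let $E_n$ be the set of edges of $G_n$ and $E_n^{(l)}$ the set of its edges of type $l$. Assume that $F\in(0,1)^{N\times N}$. Then there are deterministic constants $\psi^{(1)},\dots,\psi^{(N)}\in(0,1)$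 such that, for every $l$, $$\frac{|E_n^{(l)}|}{|E_n|}\longrightarrow\psi^{(l)}\quad\text{almost surely as } n\to\infty .$$ Moreover, $1$ is the Perron eigenvalue of $F$, that is, it is an eigenvalue of $F$ and every other complex eigenvalue has absolute value less than $1$, and $\psi=(\psi^{(1)},\dots,\psi^{(N)})$ is the normalized left Perron eigenvector of $F$, that is, the unique vector in $\mathbb{R}^N$ with $\psi F=\psi$ and $\sum_{l=1}^N\psi^{(l)}=1$. If, in addition, $F$ is symmetric, then $F$ is doubly stochastic and $\psi^{(l)}=\frac1N$ for every $l$. -/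

import Mathlib

open MeasureTheory ProbabilityTheory Filter Topology Matrix

/-- A multigraph without loops with vertex set `V` and edge set `E`; every edge carries one of
the `N` types. -/
structure TypedMultigraph (N : ℕ) (V E : Type*) where
  /-- the two endpoints of an edge -/
  ends : E → Sym2 V
  /-- there are no loops -/
  loopless : ∀ e, ¬ (ends e).IsDiag
  /-- the type of an edge -/
  type : E → Fin N

namespace TypedMultigraph

variable {N : ℕ} {V E : Type*}

/-- Every set of graphs is measurable. -/
instance : MeasurableSpace (TypedMultigraph N V E) := ⊤

/-- The finite set of edges of type `l`. -/
def edgesOfType [Fintype E] (G : TypedMultigraph N V E) (l : Fin N) : Finset E :=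
  {e : E | G.type e = l}

/-- The proportion of edges of type `l` among all edges. -/
noncomputable def edgeProportion [Fintype E] (G : TypedMultigraph N V E) (l : Fin N) : ℝ :=
  ((G.edgesOfType l).card : ℝ) / (Fintype.card E : ℝ)

open Classical in
/-- The number of edges at the vertex `v`. -/
noncomputable def degree [Fintype E] (G : TypedMultigraph N V E) (v : V) : ℕ :=
  Finset.card {e : E | v ∈ G.ends e}

open Classical in
/-- The number of edges of type `l` at the vertex `v`. -/
noncomputable def typeDegree [Fintype E] (G : TypedMultigraph N V E) (l : Fin N) (v : V) : ℕ :=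
  Finset.card {e : E | v ∈ G.ends e ∧ G.type e = l}

/-- Preferential attachment: the vertex `v` is chosen with probability proportional to its
degree. -/
noncomputable def attachProb [Fintype V] [Fintype E] (G : TypedMultigraph N V E) (v : V) : ℝ :=
  (G.degree v : ℝ) / ∑ u, (G.degree u : ℝ)

/-- The proportion of type `k` among the edges at the vertex `v`. -/
noncomputable def typeProb [Fintype E] (G : TypedMultigraph N V E) (v : V) (k : Fin N) : ℝ :=
  (G.typeDegree k v : ℝ) / (G.degree v : ℝ)

/-- Add a new vertex `none` and `M` new edges: the `i`-th one joins `none` to the old vertex `w i`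
and has type `t i`. -/
def attach {M : ℕ} (G : TypedMultigraph N V E) (w : Fin M → V) (t : Fin M → Fin N) :
    TypedMultigraph N (Option V) (E ⊕ Fin M) where
  ends := Sum.elim (fun e => (G.ends e).map some) (fun i => s(none, some (w i)))
  loopless := by
    rintro (e | i)
    · simpa [Sym2.isDiag_map (Option.some_injective V)] using G.loopless e
    · simp
  type := Sum.elim G.type t

end TypedMultigraph

/-- The vertices after `n` steps: those of the initial graph and one new vertex for each step. -/
def VertexAt (V₀ : Type*) : ℕ → Type _
  | 0 => V₀
  | n + 1 => Option (VertexAt V₀ n)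

/-- The edges after `n` steps: those of the initial graph and `M` new edges for each step. -/
def EdgeAt (E₀ : Type*) (M : ℕ) : ℕ → Type _
  | 0 => E₀
  | n + 1 => EdgeAt E₀ M n ⊕ Fin M

instance instFintypeVertexAt (V₀ : Type*) [Fintype V₀] : (n : ℕ) → Fintype (VertexAt V₀ n)
  | 0 => inferInstanceAs (Fintype V₀)
  | n + 1 =>
    letI := instFintypeVertexAt V₀ n
    inferInstanceAs (Fintype (Option (VertexAt V₀ n)))

instance instFintypeEdgeAt (E₀ : Type*) [Fintype E₀] (M : ℕ) : (n : ℕ) → Fintype (EdgeAt E₀ M n)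
  | 0 => inferInstanceAs (Fintype E₀)
  | n + 1 =>
    letI := instFintypeEdgeAt E₀ M n
    inferInstanceAs (Fintype (EdgeAt E₀ M n ⊕ Fin M))

/-- The σ-algebra generated by the graphs `G 0, …, G n`. -/
abbrev graphHistory {Ω : Type*} {N M : ℕ} {V₀ E₀ : Type*}
    (G : (n : ℕ) → Ω → TypedMultigraph N (VertexAt V₀ n) (EdgeAt E₀ M n)) (n : ℕ) :
    MeasurableSpace Ω :=
  ⨆ j ≤ n, MeasurableSpace.comap (G j) inferInstance

/-- `G` is a perturbed Barabási–Albert random graph process started from the deterministic graph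
`G₀`, with `M` new edges in each step and matrices of error probabilities `F 1, F 2, …`.
In step `n + 1`, the `i`-th new edge is attached to the old vertex `w n ω i`, first gets
the type `k n ω i`, and has the type `t n ω i` after the perturbation. -/
structure IsPerturbedBarabasiAlbert {Ω : Type*} [MeasurableSpace Ω] (μ : Measure Ω) {N M : ℕ}
    {V₀ E₀ : Type*} [Fintype V₀] [Fintype E₀] (G₀ : TypedMultigraph N V₀ E₀)
    (F : ℕ → Matrix (Fin N) (Fin N) ℝ)
    (G : (n : ℕ) → Ω → TypedMultigraph N (VertexAt V₀ n) (EdgeAt E₀ M n))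
    (w : (n : ℕ) → Ω → Fin M → VertexAt V₀ n) (k t : ℕ → Ω → Fin M → Fin N) : Prop where
  measurable_graph : ∀ n, Measurable (G n)
  measurable_endpoints : ∀ n v, MeasurableSet {ω | w n ω = v}
  measurable_first_types : ∀ n a, MeasurableSet {ω | k n ω = a}
  measurable_types : ∀ n b, MeasurableSet {ω | t n ω = b}
  /-- the initial graph -/
  graph_zero : ∀ ω, G 0 ω = G₀
  /-- the new vertex is joined to the chosen old vertices by edges of the perturbed types -/
  graph_succ : ∀ n ω, G (n + 1) ω = (G n ω).attach (w n ω) (t n ω)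
  /-- given the past of the graph, the `M` new edges are independent; each chooses its old endpoint
  with probability proportional to the current degrees, then a type according to the current
  proportions of the types at this endpoint, and then changes type `a` to `b` with probability
  `F (n + 1) a b` -/
  step_law : ∀ (n : ℕ) (v : Fin M → VertexAt V₀ n) (a b : Fin M → Fin N),
    μ⟦{ω | w n ω = v ∧ k n ω = a ∧ t n ω = b}|graphHistory G n⟧ =ᵐ[μ] fun ω =>
      ∏ i, (G n ω).attachProb (v i) * (G n ω).typeProb (v i) (a i) * F (n + 1) (a i) (b i)

/-- `ρ` is the Perron eigenvalue of the real matrix `A`: an eigenvalue which is strictly larger than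
the absolute value of every other complex eigenvalue. -/
def IsPerronEigenvalue {N : ℕ} (A : Matrix (Fin N) (Fin N) ℝ) (ρ : ℝ) : Prop :=
  (ρ : ℂ) ∈ spectrum ℂ (A.map (fun x : ℝ => (x : ℂ))) ∧
    ∀ z ∈ spectrum ℂ (A.map (fun x : ℝ => (x : ℂ))), z ≠ (ρ : ℂ) → ‖z‖ < ρ

/-!
The vector `x n` of edge proportions is a stochastic approximation of the stationary distribution
of the limiting matrix `F`. The degree of the chosen old endpoint cancels in the law of the first
type (`sum_attachProb_mul_typeProb`), so, given the past, a new edge has type `l` with probability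
`(x n F_{n+1})_l`, whatever the shape of the graph. Hence
`x (n + 1) = x n + a n (x n F_{n+1} - x n) + a n D n` with bounded martingale differences `D n` and
step sizes `a n` of order `1 / n` (`edgeProportion_succ`, `condExp_noise`).

Since `∑ (a n)² < ∞`, the noise `∑ a n D n` is a martingale bounded in `L²` and converges almost
surely (`ae_exists_tendsto_sum_of_martingaleDiff`). On a path where it converges, the tail of the
noise is added to `x n - ψ`; the result has vanishing sum and satisfies a recursion without noise,
up to an error `o(a n)`. A positive stochastic matrix contracts the `ℓ¹`-norm on vectors with
vanishing sum by a fixed factor (`sum_norm_vecMul_le`), and `∑ a n = ∞`, so `x n → ψ`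
(`tendsto_stationary_of_recursion`).

The same contraction, over `ℂ`, gives the spectral statement: an eigenvector of an eigenvalue other
than `1` has vanishing sum. Over `ℝ` it gives uniqueness of the stationary distribution.
-/

/-! ### Contraction by positive stochastic matrices -/

section Stochastic

variable {ι : Type*} [Fintype ι] [DecidableEq ι] {F : Matrix ι ι ℝ}

/-- Dobrushin's contraction: a row stochastic matrix with entries at least `c` contracts the
`ℓ¹`-norm of row vectors with vanishing sum. On such vectors `F` acts as `F - c`, whose entries are
nonnegative and whose row sums are `1 - |ι| c`. -/
theorem sum_norm_vecMul_le {𝕜 : Type*} [RCLike 𝕜] (hF : F ∈ rowStochastic ℝ ι) {c : ℝ}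
    (hc : ∀ k l, c ≤ F k l) (v : ι → 𝕜) (hv : ∑ k, v k = 0) :
    ∑ l, ‖∑ k, v k * (F k l : 𝕜)‖ ≤ (1 - Fintype.card ι * c) * ∑ k, ‖v k‖ := by
  have h1 : ∀ l, ‖∑ k, v k * (F k l : 𝕜)‖ ≤ ∑ k, ‖v k‖ * (F k l - c) := fun l => by
    have h : ∑ k, v k * (F k l : 𝕜) = ∑ k, v k * ((F k l - c : ℝ) : 𝕜) := by
      simp only [RCLike.ofReal_sub, mul_sub, Finset.sum_sub_distrib, ← Finset.sum_mul, hv]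
      simp
    rw [h]
    refine (norm_sum_le _ _).trans (Finset.sum_le_sum fun k _ => ?_)
    rw [norm_mul, RCLike.norm_ofReal, abs_of_nonneg (sub_nonneg.2 (hc k l))]
  refine (Finset.sum_le_sum fun l _ => h1 l).trans_eq ?_
  rw [Finset.sum_comm, Finset.mul_sum]
  refine Finset.sum_congr rfl fun k _ => ?_
  rw [← Finset.mul_sum, Finset.sum_sub_distrib, sum_row_of_mem_rowStochastic hF]
  simp [mul_comm]

theorem sum_vecMul_of_mem_rowStochastic {𝕜 : Type*} [RCLike 𝕜] (hF : F ∈ rowStochastic ℝ ι)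
    (v : ι → 𝕜) : ∑ l, ∑ k, v k * (F k l : 𝕜) = ∑ k, v k := by
  rw [Finset.sum_comm]
  refine Finset.sum_congr rfl fun k _ => ?_
  rw [← Finset.mul_sum, ← RCLike.ofReal_sum, sum_row_of_mem_rowStochastic hF]
  simp

theorem exists_pos_forall_le_of_pos {ι : Type*} [Finite ι] {F : Matrix ι ι ℝ}
    (hpos : ∀ k l, 0 < F k l) :
    ∃ c, 0 < c ∧ ∀ k l, c ≤ F k l := by
  rcases isEmpty_or_nonempty ι with h | h
  · exact ⟨1, one_pos, fun k => h.elim k⟩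
  · obtain ⟨p, hp⟩ := Finite.exists_min fun p : ι × ι => F p.1 p.2
    exact ⟨_, hpos p.1 p.2, fun k l => hp (k, l)⟩

/-- An eigenvector with vanishing sum belongs to an eigenvalue inside the unit disc. -/
theorem norm_lt_one_of_sum_eq_zero {𝕜 : Type*} [RCLike 𝕜] (hF : F ∈ rowStochastic ℝ ι)
    (hpos : ∀ k l, 0 < F k l) {v : ι → 𝕜} {z : 𝕜} (hv0 : v ≠ 0) (hv : ∑ k, v k = 0)
    (hz : ∀ l, ∑ k, v k * (F k l : 𝕜) = z * v l) : ‖z‖ < 1 := by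
  obtain ⟨c, hc0, hc⟩ := exists_pos_forall_le_of_pos hpos
  obtain ⟨i, hi⟩ := Function.ne_iff.1 hv0
  have : Nonempty ι := ⟨i⟩
  have h := sum_norm_vecMul_le hF hc v hv
  simp only [hz, norm_mul, ← Finset.mul_sum] at h
  have hs : 0 < ∑ k, ‖v k‖ :=
    Finset.sum_pos' (fun k _ => norm_nonneg _) ⟨i, Finset.mem_univ _, norm_pos_iff.2 hi⟩
  have h2 := le_of_mul_le_mul_right h hs
  have h3 : 0 < (Fintype.card ι : ℝ) * c := by positivity
  linarith

theorem eq_of_vecMul_eq_self (hF : F ∈ rowStochastic ℝ ι) (hpos : ∀ k l, 0 < F k l)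
    {u v : ι → ℝ} (hu : u ᵥ* F = u) (hv : v ᵥ* F = v) (h : ∑ l, u l = ∑ l, v l) : u = v := by
  by_contra hne
  have h0 : (u - v) ᵥ* F = u - v := by rw [sub_vecMul, hu, hv]
  have := norm_lt_one_of_sum_eq_zero (𝕜 := ℝ) (z := 1) hF hpos (sub_ne_zero.2 hne)
    (by simp [h]) (fun l => by simpa [vecMul, dotProduct] using congrFun h0 l)
  simp at this

theorem one_mem_spectrum_of_mem_rowStochastic [Nonempty ι] {𝕜 : Type*} [RCLike 𝕜]
    (hF : F ∈ rowStochastic ℝ ι) : (1 : 𝕜) ∈ spectrum 𝕜 (F.map (fun x : ℝ => (x : 𝕜))) := by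
  rw [spectrum.mem_iff, isUnit_iff_isUnit_det, isUnit_iff_ne_zero, not_not,
    ← exists_mulVec_eq_zero_iff]
  refine ⟨1, one_ne_zero, ?_⟩
  ext i
  have : ∑ j, (F i j : 𝕜) = 1 := by
    rw [← RCLike.ofReal_sum, sum_row_of_mem_rowStochastic hF]; simp
  rw [map_one, sub_mulVec, one_mulVec]
  simp [mulVec, dotProduct, this]

theorem exists_left_eigenvector {𝕜 : Type*} [RCLike 𝕜] {z : 𝕜}
    (hz : z ∈ spectrum 𝕜 (F.map (fun x : ℝ => (x : 𝕜)))) :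
    ∃ v : ι → 𝕜, v ≠ 0 ∧ ∀ l, ∑ k, v k * (F k l : 𝕜) = z * v l := by
  rw [spectrum.mem_iff, isUnit_iff_isUnit_det, isUnit_iff_ne_zero, not_not,
    ← exists_vecMul_eq_zero_iff] at hz
  obtain ⟨v, hv, h⟩ := hz
  refine ⟨v, hv, fun l => ?_⟩
  have h := congrFun h l
  rw [vecMul_sub, Algebra.algebraMap_eq_smul_one, vecMul_smul, vecMul_one, Pi.sub_apply,
    Pi.zero_apply, sub_eq_zero] at h
  simpa [vecMul, dotProduct] using h.symm

/-- Every eigenvalue of a positive row stochastic matrix other than `1` lies inside the unit disc: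
summing `v F = z v` over the coordinates gives `∑ v = z ∑ v`, so that `v` has vanishing sum. -/
theorem norm_lt_one_of_mem_spectrum {𝕜 : Type*} [RCLike 𝕜] (hF : F ∈ rowStochastic ℝ ι)
    (hpos : ∀ k l, 0 < F k l) {z : 𝕜} (hz : z ∈ spectrum 𝕜 (F.map (fun x : ℝ => (x : 𝕜))))
    (hz1 : z ≠ 1) : ‖z‖ < 1 := by
  obtain ⟨v, hv0, hv⟩ := exists_left_eigenvector hz
  refine norm_lt_one_of_sum_eq_zero hF hpos hv0 ?_ hv
  have h := sum_vecMul_of_mem_rowStochastic hF v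
  simp only [hv, ← Finset.mul_sum] at h
  exact (mul_left_eq_self₀.1 h).resolve_left hz1

/-- A positive row stochastic matrix has a positive stationary distribution. For a left
eigenvector `v` of the eigenvalue `1`, the vector `|v|` is stationary as well, since
`|v| ≤ |v| F` coordinatewise and both sides have the same sum. -/
theorem exists_stationary [Nonempty ι] (hF : F ∈ rowStochastic ℝ ι) (hpos : ∀ k l, 0 < F k l) :
    ∃ ψ : ι → ℝ, (∀ l, 0 < ψ l) ∧ ψ ᵥ* F = ψ ∧ ∑ l, ψ l = 1 := by
  obtain ⟨v, hv0, hv⟩ := exists_left_eigenvector (one_mem_spectrum_of_mem_rowStochastic (𝕜 := ℝ) hF)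
  simp only [RCLike.ofReal_real_eq_id, id, one_mul] at hv
  obtain ⟨i, hi⟩ := Function.ne_iff.1 hv0
  have hs : 0 < ∑ k, |v k| :=
    Finset.sum_pos' (fun k _ => abs_nonneg _) ⟨i, Finset.mem_univ _, abs_pos.2 hi⟩
  have hle : ∀ l ∈ Finset.univ, |v l| ≤ ∑ k, |v k| * F k l := fun l _ => by
    rw [← hv l]
    refine (Finset.abs_sum_le_sum_abs _ _).trans_eq (Finset.sum_congr rfl fun k _ => ?_)
    rw [abs_mul, abs_of_pos (hpos k l)]
  have hsum : ∑ l, |v l| = ∑ l, ∑ k, |v k| * F k l := by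
    simpa using (sum_vecMul_of_mem_rowStochastic hF fun k => |v k|).symm
  have heq := (Finset.sum_eq_sum_iff_of_le hle).1 hsum
  refine ⟨fun l => (∑ k, |v k|)⁻¹ * |v l|, fun l => ?_, ?_, ?_⟩
  · refine mul_pos (inv_pos.2 hs) ?_
    rw [heq l (Finset.mem_univ _)]
    exact Finset.sum_pos' (fun k _ => mul_nonneg (abs_nonneg _) (hpos k l).le)
      ⟨i, Finset.mem_univ _, mul_pos (abs_pos.2 hi) (hpos i l)⟩
  · ext l
    simp only [vecMul, dotProduct, mul_assoc, ← Finset.mul_sum]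
    rw [← heq l (Finset.mem_univ _)]
  · rw [← Finset.mul_sum, inv_mul_cancel₀ hs.ne']

end Stochastic

/-! ### A perturbed linear recursion -/

/-- A nonnegative sequence with `u (n + 1) ≤ (1 - δ a n) u n + a n b n`, where `b → 0` and
`∑ a n = ∞`, tends to zero: once `b ≤ δ ε`, the excess of `u` over `ε` shrinks by the factor
`1 - δ a n ≤ exp (-δ a n)`. -/
theorem tendsto_zero_of_recursive_le {u a b : ℕ → ℝ} {δ : ℝ} (hδ : 0 < δ)
    (hu : ∀ n, 0 ≤ u n) (ha : ∀ n, 0 ≤ a n) (hδa : ∀ n, δ * a n ≤ 1)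
    (hsum : Tendsto (fun n => ∑ j ∈ Finset.range n, a j) atTop atTop)
    (hb : Tendsto b atTop (𝓝 0))
    (hrec : ∀ n, u (n + 1) ≤ (1 - δ * a n) * u n + a n * b n) : Tendsto u atTop (𝓝 0) := by
  refine tendsto_order.2 ⟨fun x hx => Eventually.of_forall fun n => hx.trans_le (hu n),
    fun x hx => ?_⟩
  obtain ⟨n₀, hn₀⟩ := eventually_atTop.1
    (hb.eventually_le_const (show (0 : ℝ) < δ * (x / 2) by positivity))
  set s : ℕ → ℝ := fun n => ∑ j ∈ Finset.range n, a j with hs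
  have key : ∀ n, n₀ ≤ n → u n - x / 2 ≤ u n₀ * Real.exp (-(δ * (s n - s n₀))) := by
    intro n hn
    induction n, hn using Nat.le_induction with
    | base => simp; linarith
    | succ n hn ih =>
      have h1 : s (n + 1) = s n + a n := Finset.sum_range_succ _ _
      have h2 : u (n + 1) - x / 2 ≤ (1 - δ * a n) * (u n - x / 2) := by
        nlinarith [hrec n, mul_le_mul_of_nonneg_left (hn₀ n hn) (ha n)]
      have h3 : 1 - δ * a n ≤ Real.exp (-(δ * a n)) := by
        linarith [Real.add_one_le_exp (-(δ * a n))]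
      calc u (n + 1) - x / 2 ≤ (1 - δ * a n) * (u n - x / 2) := h2
        _ ≤ (1 - δ * a n) * (u n₀ * Real.exp (-(δ * (s n - s n₀)))) :=
            mul_le_mul_of_nonneg_left ih (sub_nonneg.2 (hδa n))
        _ ≤ Real.exp (-(δ * a n)) * (u n₀ * Real.exp (-(δ * (s n - s n₀)))) :=
            mul_le_mul_of_nonneg_right h3 (mul_nonneg (hu _) (Real.exp_pos _).le)
        _ = u n₀ * Real.exp (-(δ * (s (n + 1) - s n₀))) := by
            rw [h1, mul_left_comm, ← Real.exp_add]; ring_nf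
  have hlim : Tendsto (fun n => u n₀ * Real.exp (-(δ * (s n - s n₀)))) atTop (𝓝 0) := by
    have h : Tendsto (fun n => δ * (s n - s n₀)) atTop atTop :=
      (tendsto_atTop_add_const_right _ (-s n₀) hsum).const_mul_atTop hδ
    simpa using (Real.tendsto_exp_neg_atTop_nhds_zero.comp h).const_mul (u n₀)
  filter_upwards [eventually_ge_atTop n₀, hlim.eventually_lt_const (half_pos hx)] with n hn h
  linarith [key n hn]

/-- Robbins–Monro convergence along one path: probability vectors `x n` which move by `a n` in the
direction of `x n F` and receive noise with convergent sum `S` tend to the stationary distribution.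
Adding the tail of the noise to `x n - ψ` gives a vector with vanishing sum that satisfies the
recursion without noise, up to an error that tends to zero. -/
theorem tendsto_stationary_of_recursion {ι : Type*} [Fintype ι] [DecidableEq ι] [Nonempty ι]
    {F : Matrix ι ι ℝ} (hF : F ∈ rowStochastic ℝ ι) (hpos : ∀ k l, 0 < F k l)
    {Fs : ℕ → Matrix ι ι ℝ} (hlim : ∀ k l, Tendsto (fun n => Fs n k l) atTop (𝓝 (F k l)))
    (hFs : ∀ n, Fs n ∈ rowStochastic ℝ ι)
    {ψ : ι → ℝ} (hψ : ψ ᵥ* F = ψ) (hψ1 : ∑ l, ψ l = 1)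
    {x S : ℕ → ι → ℝ} (hx0 : ∀ n l, 0 ≤ x n l) (hx1 : ∀ n, ∑ l, x n l = 1)
    {a : ℕ → ℝ} (ha0 : ∀ n, 0 ≤ a n) (ha1 : ∀ n, a n ≤ 1)
    (hsum : Tendsto (fun n => ∑ j ∈ Finset.range n, a j) atTop atTop)
    (hS0 : ∀ l, S 0 l = 0)
    (hrec : ∀ n l, x (n + 1) l =
      x n l + a n * ((x n ᵥ* Fs n) l - x n l) + (S (n + 1) l - S n l))
    (hS : ∀ l, ∃ s, Tendsto (fun n => S n l) atTop (𝓝 s)) (l : ι) :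
    Tendsto (fun n => x n l) atTop (𝓝 (ψ l)) := by
  choose s hs using hS
  obtain ⟨c, hc0, hc⟩ := exists_pos_forall_le_of_pos hpos
  have hδ : 0 < (Fintype.card ι : ℝ) * c := by positivity
  have hδ1 : (Fintype.card ι : ℝ) * c ≤ 1 := by
    rw [← sum_row_of_mem_rowStochastic hF (Classical.arbitrary ι), ← nsmul_eq_mul]
    exact Finset.card_nsmul_le_sum _ _ _ fun l _ => hc _ _
  have hvec : ∀ (A : Matrix ι ι ℝ) (v : ι → ℝ) l, (v ᵥ* A) l = ∑ k, v k * A k l :=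
    fun _ _ _ => rfl
  have hsumvec : ∀ A ∈ rowStochastic ℝ ι, ∀ v : ι → ℝ, ∑ l, (v ᵥ* A) l = ∑ k, v k :=
    fun A hA v => by simpa [hvec] using sum_vecMul_of_mem_rowStochastic hA v
  have hSsum : ∀ n, ∑ l, S n l = 0 := by
    intro n
    induction n with
    | zero => simp [hS0]
    | succ n ih =>
      have h := hx1 (n + 1)
      simp only [hrec, Finset.sum_add_distrib, Finset.sum_sub_distrib, ← Finset.mul_sum, hx1, ih,
        hsumvec _ (hFs n)] at h
      linarith
  have hssum : ∑ l, s l = 0 := by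
    have h : Tendsto (fun n => ∑ l, S n l) atTop (𝓝 (∑ l, s l)) :=
      tendsto_finsetSum _ fun l _ => hs l
    simp only [hSsum] at h
    exact tendsto_nhds_unique h tendsto_const_nhds
  set T : ℕ → ι → ℝ := fun n l => s l - S n l with hT
  have hT0 : ∀ l, Tendsto (fun n => T n l) atTop (𝓝 0) := fun l => by
    simpa using (hs l).const_sub (s l)
  set z : ℕ → ι → ℝ := fun n l => x n l - ψ l + T n l with hz
  have hzsum : ∀ n, ∑ l, z n l = 0 := fun n => by
    simp only [hz, hT, Finset.sum_add_distrib, Finset.sum_sub_distrib, hx1, hψ1, hssum, hSsum]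
    simp
  set r : ℕ → ι → ℝ := fun n l =>
    ∑ k, x n k * (Fs n k l - F k l) - (∑ k, T n k * F k l - T n l) with hr
  have hzrec : ∀ n l, z (n + 1) l =
      (1 - a n) * z n l + a n * ∑ k, z n k * F k l + a n * r n l := fun n l => by
    have h1 := hrec n l
    have h2 : ∑ k, ψ k * F k l = ψ l := congrFun hψ l
    simp only [hz, hr, hT, hvec, add_mul, sub_mul, mul_sub, Finset.sum_add_distrib,
      Finset.sum_sub_distrib] at h1 ⊢
    rw [h1, h2]
    ring
  have hx1' : ∀ n k, x n k ≤ 1 := fun n k =>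
    (Finset.single_le_sum (fun i _ => hx0 n i) (Finset.mem_univ k)).trans_eq (hx1 n)
  have hr0 : ∀ l, Tendsto (fun n => r n l) atTop (𝓝 0) := fun l => by
    have h1 : ∀ k, Tendsto (fun n => x n k * (Fs n k l - F k l)) atTop (𝓝 0) := fun k => by
      refine bdd_le_mul_tendsto_zero' 1 (Eventually.of_forall fun n => ?_) ?_
      · rw [abs_of_nonneg (hx0 n k)]; exact hx1' n k
      · simpa using (hlim k l).sub_const (F k l)
    have h2 : ∀ k, Tendsto (fun n => T n k * F k l) atTop (𝓝 0) := fun k => by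
      simpa using (hT0 k).mul_const (F k l)
    simpa using (tendsto_finsetSum Finset.univ fun k _ => h1 k).sub
      ((tendsto_finsetSum Finset.univ fun k _ => h2 k).sub (hT0 l))
  have hb0 : Tendsto (fun n => ∑ l, |r n l|) atTop (𝓝 0) := by
    simpa using tendsto_finsetSum Finset.univ fun l _ => (hr0 l).abs
  have hu : Tendsto (fun n => ∑ l, |z n l|) atTop (𝓝 0) := by
    refine tendsto_zero_of_recursive_le hδ (fun n => Finset.sum_nonneg fun l _ => abs_nonneg _) ha0
      (fun n => mul_le_one₀ hδ1 (ha0 n) (ha1 n)) hsum hb0 fun n => ?_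
    have hcon : ∑ l, |∑ k, z n k * F k l| ≤ (1 - Fintype.card ι * c) * ∑ l, |z n l| := by
      simpa using sum_norm_vecMul_le hF hc (z n) (hzsum n)
    calc ∑ l, |z (n + 1) l|
        ≤ ∑ l, ((1 - a n) * |z n l| + a n * |∑ k, z n k * F k l| + a n * |r n l|) := by
          refine Finset.sum_le_sum fun l _ => ?_
          rw [hzrec]
          refine (abs_add_three _ _ _).trans_eq ?_
          rw [abs_mul, abs_mul, abs_mul, abs_of_nonneg (ha0 n),
            abs_of_nonneg (sub_nonneg.2 (ha1 n))]
      _ = (1 - a n) * ∑ l, |z n l| + a n * ∑ l, |∑ k, z n k * F k l| + a n * ∑ l, |r n l| := by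
          simp only [Finset.sum_add_distrib, ← Finset.mul_sum]
      _ ≤ _ := by nlinarith [mul_le_mul_of_nonneg_left hcon (ha0 n)]
  have hz0 : Tendsto (fun n => z n l) atTop (𝓝 0) :=
    squeeze_zero_norm (fun n => Finset.single_le_sum (f := fun l => |z n l|)
      (fun i _ => abs_nonneg _) (Finset.mem_univ l)) hu
  have h := (hz0.sub (hT0 l)).add_const (ψ l)
  simpa [hz] using h

/-! ### Weighted sums of bounded martingale differences -/

/-- If `D` is a bounded sequence of martingale differences and `∑ (a n)²` converges, then
`∑ a n D n` converges almost surely: the partial sums form a martingale that is bounded in `L²`,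
because the increments are orthogonal. -/
theorem ae_exists_tendsto_sum_of_martingaleDiff {Ω : Type*} {mΩ : MeasurableSpace Ω}
    {μ : Measure Ω} [IsProbabilityMeasure μ] (ℱ : Filtration ℕ mΩ) {D : ℕ → Ω → ℝ} {C : ℝ}
    (hmeas : ∀ n, StronglyMeasurable[ℱ (n + 1)] (D n)) (hbdd : ∀ n ω, |D n ω| ≤ C)
    (hcond : ∀ n, μ[D n | ℱ n] =ᵐ[μ] 0) {a : ℕ → ℝ} (ha : Summable fun n => a n ^ 2) :
    ∀ᵐ ω ∂μ, ∃ s, Tendsto (fun n => ∑ j ∈ Finset.range n, a j * D j ω) atTop (𝓝 s) := by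
  set f : ℕ → Ω → ℝ := fun n ω => ∑ j ∈ Finset.range n, a j * D j ω with hf
  have hadp : StronglyAdapted ℱ f := fun n =>
    Finset.stronglyMeasurable_fun_sum _ fun j hj =>
      ((hmeas j).mono (ℱ.mono (Finset.mem_range.1 hj))).const_mul _
  have hfb : ∀ n ω, |f n ω| ≤ ∑ j ∈ Finset.range n, |a j| * C := fun n ω =>
    (Finset.abs_sum_le_sum_abs _ _).trans <| Finset.sum_le_sum fun j _ => by
      rw [abs_mul]; exact mul_le_mul_of_nonneg_left (hbdd j ω) (abs_nonneg _)
  have hDm : ∀ n, AEStronglyMeasurable (D n) μ := fun n =>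
    ((hmeas n).mono (ℱ.le _)).aestronglyMeasurable
  have hfm : ∀ n, AEStronglyMeasurable (f n) μ := fun n =>
    ((hadp n).mono (ℱ.le _)).aestronglyMeasurable
  have hDint : ∀ n, Integrable (D n) μ := fun n =>
    .of_bound (hDm n) C (ae_of_all _ (hbdd n))
  have hfint : ∀ n, Integrable (f n) μ := fun n =>
    .of_bound (hfm n) _ (ae_of_all _ (hfb n))
  have hf2 : ∀ n, Integrable (fun ω => f n ω ^ 2) μ := fun n => by
    simpa only [pow_two] using (hfint n).mul_bdd (hfm n) (ae_of_all _ (hfb n))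
  have hfD : ∀ n, Integrable (f n * D n) μ := fun n =>
    (hfint n).mul_bdd (hDm n) (ae_of_all _ (hbdd n))
  have hD2 : ∀ n, Integrable (fun ω => D n ω ^ 2) μ := fun n => by
    simpa only [pow_two] using (hDint n).mul_bdd (hDm n) (ae_of_all _ (hbdd n))
  have hsucc : ∀ n ω, f (n + 1) ω = f n ω + a n * D n ω := fun n ω =>
    Finset.sum_range_succ _ _
  have hmart : Martingale f ℱ μ := by
    refine martingale_of_condExp_sub_eq_zero_nat hadp hfint fun n => ?_
    have h1 : f (n + 1) - f n = a n • D n := by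
      ext ω; simp [hsucc]
    rw [h1]
    filter_upwards [condExp_smul (a n) (D n) (ℱ n), hcond n] with ω h2 h3
    rw [h2, Pi.smul_apply, h3]
    simp
  have horth : ∀ n, ∫ ω, f n ω * D n ω ∂μ = 0 := fun n => by
    have h1 : μ[f n * D n | ℱ n] =ᵐ[μ] 0 := by
      filter_upwards [condExp_mul_of_stronglyMeasurable_left (hadp n) (hfD n) (hDint n),
        hcond n] with ω h2 h3
      rw [h2, Pi.mul_apply, h3]
      simp
    have h2 := integral_condExp (μ := μ) (f := f n * D n) (ℱ.le n)
    rw [integral_congr_ae h1] at h2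
    simpa using h2.symm
  have hL2 : ∀ n, ∫ ω, f n ω ^ 2 ∂μ ≤ ∑ j ∈ Finset.range n, a j ^ 2 * C ^ 2 := by
    intro n
    induction n with
    | zero => simp [hf]
    | succ n ih =>
      have h1 : ∀ ω, f (n + 1) ω ^ 2 =
          f n ω ^ 2 + (2 * a n) * (f n ω * D n ω) + a n ^ 2 * D n ω ^ 2 := fun ω => by
        rw [hsucc]; ring
      have h2 : ∫ ω, D n ω ^ 2 ∂μ ≤ C ^ 2 := by
        refine (integral_mono (hD2 n) (integrable_const (C ^ 2)) fun ω => ?_).trans_eq (by simp)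
        exact sq_le_sq' (abs_le.1 (hbdd n ω)).1 (abs_le.1 (hbdd n ω)).2
      simp only [h1]
      have h3 : Integrable (fun ω => 2 * a n * (f n ω * D n ω)) μ := (hfD n).const_mul _
      have h4 : Integrable (fun ω => f n ω ^ 2 + 2 * a n * (f n ω * D n ω)) μ := (hf2 n).add h3
      rw [integral_add h4 ((hD2 n).const_mul _), integral_add (hf2 n) h3,
        integral_const_mul, integral_const_mul,
        horth, Finset.sum_range_succ]
      nlinarith [mul_le_mul_of_nonneg_left h2 (sq_nonneg (a n))]
  set R : ℝ := 1 + (∑' j, a j ^ 2) * C ^ 2 with hR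
  have hL1 : ∀ n, eLpNorm (f n) 1 μ ≤ (R.toNNReal : ENNReal) := fun n => by
    rw [eLpNorm_one_eq_lintegral_enorm, ← ofReal_integral_norm_eq_lintegral_enorm (hfint n)]
    refine ENNReal.ofReal_le_ofReal ?_
    calc ∫ ω, ‖f n ω‖ ∂μ ≤ ∫ ω, (1 + f n ω ^ 2) ∂μ := by
          refine integral_mono (hfint n).norm ((integrable_const _).add (hf2 n)) fun ω => ?_
          simp only [Real.norm_eq_abs, ← sq_abs (f n ω)]
          nlinarith [sq_nonneg (|f n ω| - 1), abs_nonneg (f n ω)]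
      _ = 1 + ∫ ω, f n ω ^ 2 ∂μ := by
          rw [integral_add (integrable_const _) (hf2 n)]; simp
      _ ≤ R := by
          refine add_le_add_right ((hL2 n).trans ?_) 1
          rw [← Finset.sum_mul]
          exact mul_le_mul_of_nonneg_right (ha.sum_le_tsum _ fun j _ => sq_nonneg _) (sq_nonneg _)
  exact hmart.submartingale.exists_ae_tendsto_of_bdd hL1

/-! ### Degrees and edge types of a multigraph -/

namespace TypedMultigraph

variable {N : ℕ} {V E : Type*} [Fintype E] (G : TypedMultigraph N V E)

open Classical in
/-- Double counting of incidences: an edge has exactly two endpoints, since it is not a loop. -/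
theorem sum_card_filter_mem_ends {E : Type*} (G : TypedMultigraph N V E) [Fintype V]
    (s : Finset E) :
    ∑ v, Finset.card {e ∈ s | v ∈ G.ends e} = 2 * s.card := by
  have h : ∀ e, Finset.card {v : V | v ∈ G.ends e} = 2 := fun e => by
    rw [← Sym2.card_toFinset_of_not_isDiag _ (G.loopless e)]
    congr 1
    ext v
    simp
  have h2 := Finset.sum_card_bipartiteAbove_eq_sum_card_bipartiteBelow
    (s := Finset.univ) (t := s) fun v e => v ∈ G.ends e
  simp only [Finset.bipartiteAbove, Finset.bipartiteBelow, h] at h2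
  rw [h2, Finset.sum_const, smul_eq_mul, mul_comm]

theorem sum_degree [Fintype V] : ∑ v, G.degree v = 2 * Fintype.card E :=
  G.sum_card_filter_mem_ends (Finset.univ : Finset E)

theorem sum_typeDegree [Fintype V] (l : Fin N) :
    ∑ v, G.typeDegree l v = 2 * (G.edgesOfType l).card := by
  rw [← G.sum_card_filter_mem_ends]
  refine Finset.sum_congr rfl fun v _ => ?_
  unfold typeDegree
  congr 1
  ext e
  simp [edgesOfType, and_comm]

theorem typeDegree_le_degree (l : Fin N) (v : V) : G.typeDegree l v ≤ G.degree v := by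
  classical
  unfold typeDegree degree
  exact Finset.card_le_card (Finset.monotone_filter_right _ fun e _ h => h.1)

/-- The first type of a new edge is `l` with probability equal to the overall proportion of
type `l`: the degree of the chosen vertex cancels, and the typed degrees and the degrees sum up to
twice the numbers of edges. -/
theorem sum_attachProb_mul_typeProb [Fintype V] (l : Fin N) :
    ∑ v, G.attachProb v * G.typeProb v l = G.edgeProportion l := by
  have h : ∀ v, G.attachProb v * G.typeProb v l =
      (G.typeDegree l v : ℝ) / ∑ u, (G.degree u : ℝ) := fun v => by
    unfold attachProb typeProb
    rcases Nat.eq_zero_or_pos (G.degree v) with h0 | h0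
    · have : G.typeDegree l v = 0 := Nat.le_zero.1 (h0 ▸ G.typeDegree_le_degree l v)
      simp [h0, this]
    · have : (G.degree v : ℝ) ≠ 0 := by positivity
      field_simp
  rw [Finset.sum_congr rfl fun v _ => h v, ← Finset.sum_div, ← Nat.cast_sum, ← Nat.cast_sum,
    sum_degree, sum_typeDegree, edgeProportion]
  push_cast
  exact mul_div_mul_left _ _ two_ne_zero

theorem edgeProportion_nonneg (l : Fin N) : 0 ≤ G.edgeProportion l := by
  unfold edgeProportion; positivity

theorem sum_edgeProportion [Nonempty E] : ∑ l, G.edgeProportion l = 1 := by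
  unfold edgeProportion
  rw [← Finset.sum_div, ← Nat.cast_sum, div_eq_one_iff_eq (by positivity)]
  norm_cast
  exact (Finset.card_eq_sum_card_fiberwise (f := G.type) (t := Finset.univ) (by simp)).symm

theorem vecMul_edgeProportion_mem_Icc [Nonempty E] {A : Matrix (Fin N) (Fin N) ℝ}
    (hA : A ∈ rowStochastic ℝ (Fin N)) (l : Fin N) :
    ((fun a => G.edgeProportion a) ᵥ* A) l ∈ Set.Icc (0 : ℝ) 1 := by
  refine ⟨nonneg_vecMul_of_mem_rowStochastic hA (fun a => G.edgeProportion_nonneg a) l, ?_⟩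
  rw [← G.sum_edgeProportion]
  simp only [vecMul, dotProduct]
  exact Finset.sum_le_sum fun a _ => mul_le_of_le_one_right
    (G.edgeProportion_nonneg a) (le_one_of_mem_rowStochastic hA)

theorem card_edgesOfType_attach {M : ℕ} (w : Fin M → V) (t : Fin M → Fin N) (l : Fin N) :
    ((G.attach w t).edgesOfType l).card =
      (G.edgesOfType l).card + Finset.card {i | t i = l} := by
  unfold edgesOfType
  rw [Finset.card_filter, Finset.card_filter, Finset.card_filter, Fintype.sum_sum_type]
  rfl

end TypedMultigraph

theorem card_edgeAt (E₀ : Type*) [Fintype E₀] (M : ℕ) (n : ℕ) :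
    Fintype.card (EdgeAt E₀ M n) = Fintype.card E₀ + n * M := by
  induction n with
  | zero => rw [zero_mul, add_zero]; rfl
  | succ n ih =>
    have h : Fintype.card (EdgeAt E₀ M (n + 1)) = Fintype.card (EdgeAt E₀ M n ⊕ Fin M) := rfl
    rw [h, Fintype.card_sum, ih, Fintype.card_fin]
    ring

theorem nonempty_edgeAt (E₀ : Type*) [Fintype E₀] [Nonempty E₀] (M n : ℕ) :
    Nonempty (EdgeAt E₀ M n) := by
  rw [← Fintype.card_pos_iff, card_edgeAt]
  exact Nat.add_pos_left Fintype.card_pos _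

/-! ### The types of the new edges -/

/-- The expected number of trials with outcome `l` among `M` independent trials with outcome
probabilities `q`, written as a sum over all outcomes. -/
theorem sum_card_filter_mul_prod {κ : Type*} [Fintype κ] [DecidableEq κ] {M : ℕ} {q : κ → ℝ}
    (hq : ∑ x, q x = 1) (l : κ) :
    ∑ b : Fin M → κ, (Finset.card {i | b i = l} : ℝ) * ∏ i, q (b i) = M * q l := by
  have h : ∀ i : Fin M, ∑ b : Fin M → κ, (if b i = l then (1 : ℝ) else 0) * ∏ j, q (b j) = q l := by
    intro i
    -- The constraint on the `i`-th outcome is moved into the `i`-th factor of the product.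
    have h1 : ∀ b : Fin M → κ, (if b i = l then (1 : ℝ) else 0) * ∏ j, q (b j) =
        ∏ j, (if j = i then if b j = l then (1 : ℝ) else 0 else 1) * q (b j) := fun b => by
      rw [Finset.prod_mul_distrib, Finset.prod_ite_eq' Finset.univ i
        (fun j => if b j = l then (1 : ℝ) else 0), if_pos (Finset.mem_univ i)]
    rw [Finset.sum_congr rfl fun b _ => h1 b, ← Fintype.piFinset_univ,
      ← Finset.prod_univ_sum (fun _ => Finset.univ)
        (fun j x => (if j = i then if x = l then (1 : ℝ) else 0 else 1) * q x),
      Finset.prod_eq_single i]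
    · simp
    · intro j _ hj
      simp [hj, hq]
    · simp
  simp only [Finset.card_filter, Nat.cast_sum, Nat.cast_ite, Nat.cast_one, Nat.cast_zero,
    Finset.sum_mul]
  rw [Finset.sum_comm, Finset.sum_congr rfl fun i _ => h i]
  simp

namespace IsPerturbedBarabasiAlbert

variable {Ω : Type*} [mΩ : MeasurableSpace Ω] {μ : Measure Ω} {N M : ℕ} {V₀ E₀ : Type*}
  [Fintype V₀] [Fintype E₀] {G₀ : TypedMultigraph N V₀ E₀} {F : ℕ → Matrix (Fin N) (Fin N) ℝ}
  {G : (n : ℕ) → Ω → TypedMultigraph N (VertexAt V₀ n) (EdgeAt E₀ M n)}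
  {w : (n : ℕ) → Ω → Fin M → VertexAt V₀ n} {k t : ℕ → Ω → Fin M → Fin N}

/-- The filtration generated by the graphs. -/
def filtration (hG : IsPerturbedBarabasiAlbert μ G₀ F G w k t) : Filtration ℕ mΩ where
  seq := graphHistory G
  mono' := fun _ _ hmn => iSup₂_mono' fun j hj => ⟨j, hj.trans hmn, le_rfl⟩
  le' := fun _ => iSup₂_le fun j _ => (hG.measurable_graph j).comap_le

/-- Every quantity computed from the `j`-th graph is known at time `n ≥ j`. -/
theorem stronglyMeasurable_comp (hG : IsPerturbedBarabasiAlbert μ G₀ F G w k t) {j n : ℕ}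
    (hj : j ≤ n) (f : TypedMultigraph N (VertexAt V₀ j) (EdgeAt E₀ M j) → ℝ) :
    StronglyMeasurable[hG.filtration n] fun ω => f (G j ω) := by
  have h1 : MeasurableSpace.comap (G j) inferInstance ≤ hG.filtration n :=
    le_iSup₂_of_le (f := fun j (_ : j ≤ n) => MeasurableSpace.comap (G j) inferInstance) j hj le_rfl
  have h2 : Measurable[hG.filtration n] (G j) := measurable_iff_comap_le.2 h1
  exact (Measurable.comp (g := f) (fun _ _ => trivial) h2).stronglyMeasurable

theorem card_edgesOfType_succ (hG : IsPerturbedBarabasiAlbert μ G₀ F G w k t) (n : ℕ) (ω : Ω)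
    (l : Fin N) : ((G (n + 1) ω).edgesOfType l).card =
      ((G n ω).edgesOfType l).card + Finset.card {i | t n ω i = l} := by
  rw [hG.graph_succ]
  exact TypedMultigraph.card_edgesOfType_attach _ _ _ _

/-- The expected number of new edges of type `l`, given the past, is `M` times the `l`-th
coordinate of the vector of edge proportions multiplied by the error matrix. -/
theorem condExp_card_newEdges [IsProbabilityMeasure μ] [Nonempty E₀]
    (hG : IsPerturbedBarabasiAlbert μ G₀ F G w k t)
    (hF : ∀ n, 1 ≤ n → F n ∈ rowStochastic ℝ (Fin N)) (n : ℕ) (l : Fin N) :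
    μ[fun ω => (Finset.card {i | t n ω i = l} : ℝ) | hG.filtration n] =ᵐ[μ] fun ω =>
      M * ((fun a => (G n ω).edgeProportion a) ᵥ* F (n + 1)) l := by
  classical
  let P := (Fin M → VertexAt V₀ n) × (Fin M → Fin N) × (Fin M → Fin N)
  let A : P → Set Ω := fun p => {ω | w n ω = p.1 ∧ k n ω = p.2.1 ∧ t n ω = p.2.2}
  have hA : ∀ p, MeasurableSet (A p) := fun p =>
    (hG.measurable_endpoints n p.1).inter
      ((hG.measurable_first_types n p.2.1).inter (hG.measurable_types n p.2.2))
  let c : P → ℝ := fun p => (Finset.card {i | p.2.2 i = l} : ℝ)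
  have hdec : (fun ω => (Finset.card {i | t n ω i = l} : ℝ)) =
      ∑ p : P, c p • (A p).indicator fun _ => (1 : ℝ) := by
    ext ω
    rw [Finset.sum_apply, Finset.sum_eq_single (w n ω, k n ω, t n ω)]
    · simp [A, c]
    · rintro ⟨v, a, b⟩ _ hne
      have : ω ∉ A (v, a, b) := fun ⟨h1, h2, h3⟩ => hne (by simp [h1, h2, h3])
      simp [this]
    · simp
  have hint : ∀ p ∈ Finset.univ, Integrable (c p • (A p).indicator fun _ => (1 : ℝ)) μ :=
    fun p _ => ((integrable_const _).indicator (hA p)).smul _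
  have hsmul : ∀ᵐ ω ∂μ, ∀ p : P,
      (μ[c p • (A p).indicator fun _ => (1 : ℝ) | hG.filtration n]) ω =
        c p * ∏ i, (G n ω).attachProb (p.1 i) * (G n ω).typeProb (p.1 i) (p.2.1 i) *
          F (n + 1) (p.2.1 i) (p.2.2 i) := by
    refine ae_all_iff.2 fun p => ?_
    filter_upwards [condExp_smul (μ := μ) (c p) ((A p).indicator fun _ => (1 : ℝ))
      (hG.filtration n), hG.step_law n p.1 p.2.1 p.2.2] with ω h1 h2
    rw [h1, Pi.smul_apply, smul_eq_mul]
    exact congrArg _ h2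
  rw [hdec]
  filter_upwards [condExp_finsetSum hint (hG.filtration n), hsmul] with ω h1 h2
  rw [h1, Finset.sum_apply, Finset.sum_congr rfl fun p _ => h2 p]
  have := nonempty_edgeAt E₀ M n
  set q : Fin N → ℝ := (fun a => (G n ω).edgeProportion a) ᵥ* F (n + 1) with hq
  have hq1 : ∑ x, q x = 1 := by
    have h := sum_vecMul_of_mem_rowStochastic (𝕜 := ℝ) (hF (n + 1) (by omega))
      fun a => (G n ω).edgeProportion a
    rw [TypedMultigraph.sum_edgeProportion] at h
    simpa [hq, vecMul, dotProduct] using h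
  -- Summing over the old endpoints and the first types leaves the law of the final types.
  have hsum : ∀ b : Fin M → Fin N, ∑ v : Fin M → VertexAt V₀ n, ∑ a : Fin M → Fin N,
      ∏ i, (G n ω).attachProb (v i) * (G n ω).typeProb (v i) (a i) * F (n + 1) (a i) (b i) =
        ∏ i, q (b i) := fun b => by
    rw [Finset.sum_comm]
    have h3 : ∀ a : Fin M → Fin N, ∑ v : Fin M → VertexAt V₀ n,
        ∏ i, (G n ω).attachProb (v i) * (G n ω).typeProb (v i) (a i) * F (n + 1) (a i) (b i) =
          ∏ i, (G n ω).edgeProportion (a i) * F (n + 1) (a i) (b i) := fun a => by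
      rw [← Fintype.piFinset_univ, ← Finset.prod_univ_sum (fun _ => Finset.univ) fun i v =>
        (G n ω).attachProb v * (G n ω).typeProb v (a i) * F (n + 1) (a i) (b i)]
      simp only [← Finset.sum_mul, TypedMultigraph.sum_attachProb_mul_typeProb]
    rw [Finset.sum_congr rfl fun a _ => h3 a, ← Fintype.piFinset_univ,
      ← Finset.prod_univ_sum (fun _ => Finset.univ) fun i a =>
        (G n ω).edgeProportion a * F (n + 1) a (b i)]
    rfl
  rw [← sum_card_filter_mul_prod hq1 l]
  simp only [P, c, Fintype.sum_prod_type]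
  simp only [← hsum, Finset.mul_sum]
  exact (Finset.sum_congr rfl fun v _ => Finset.sum_comm).trans Finset.sum_comm

/-! ### The edge proportions as a stochastic approximation -/

/-- The step size of the edge proportions: the share of the new edges in all edges. -/
noncomputable def stepSize (E₀ : Type*) [Fintype E₀] (M n : ℕ) : ℝ :=
  M / (Fintype.card E₀ + (n + 1) * M)

/-- The noise in step `n + 1`: the proportion of type `l` among the new edges minus its
conditional expectation. -/
noncomputable def noise (F : ℕ → Matrix (Fin N) (Fin N) ℝ)
    (G : (n : ℕ) → Ω → TypedMultigraph N (VertexAt V₀ n) (EdgeAt E₀ M n))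
    (t : ℕ → Ω → Fin M → Fin N) (l : Fin N) (n : ℕ) (ω : Ω) : ℝ :=
  (Finset.card {i | t n ω i = l} : ℝ) / M -
    ((fun a => (G n ω).edgeProportion a) ᵥ* F (n + 1)) l

theorem stepSize_nonneg (n : ℕ) : 0 ≤ stepSize E₀ M n := by
  unfold stepSize; positivity

theorem stepSize_le (hM : 0 < M) (n : ℕ) : stepSize E₀ M n ≤ 1 / ((n : ℝ) + 1) := by
  have : (0 : ℝ) < M := by exact_mod_cast hM
  unfold stepSize
  rw [div_le_div_iff₀ (by positivity) (by positivity)]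
  have : (0 : ℝ) ≤ Fintype.card E₀ := by positivity
  nlinarith

theorem le_stepSize (hM : 0 < M) (n : ℕ) :
    ((Fintype.card E₀ : ℝ) + 1)⁻¹ * (1 / ((n : ℝ) + 1)) ≤ stepSize E₀ M n := by
  have h1 : (1 : ℝ) ≤ M := by exact_mod_cast hM
  unfold stepSize
  rw [inv_mul_eq_div, div_div, div_le_div_iff₀ (by positivity) (by positivity)]
  have h2 : (Fintype.card E₀ : ℝ) ≤ Fintype.card E₀ * M * (n + 1) := by
    rw [mul_assoc]
    exact le_mul_of_one_le_right (by positivity)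
      (one_le_mul_of_one_le_of_one_le h1 (by linarith [n.cast_nonneg (α := ℝ)]))
  nlinarith

theorem summable_stepSize_sq (hM : 0 < M) : Summable fun n => stepSize E₀ M n ^ 2 := by
  have h : Summable fun n : ℕ => (1 / ((n : ℝ) + 1)) ^ 2 := by
    have := (summable_nat_add_iff 1).2 (Real.summable_one_div_nat_pow.2 (one_lt_two (α := ℕ)))
    simpa using this
  exact h.of_nonneg_of_le (fun n => sq_nonneg _) fun n =>
    pow_le_pow_left₀ (stepSize_nonneg n) (stepSize_le hM n) 2

theorem tendsto_sum_stepSize (hM : 0 < M) :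
    Tendsto (fun n => ∑ j ∈ Finset.range n, stepSize E₀ M j) atTop atTop := by
  refine tendsto_atTop_mono (fun n => Finset.sum_le_sum fun j _ => le_stepSize hM j) ?_
  simp only [← Finset.mul_sum]
  exact Real.tendsto_sum_range_one_div_nat_succ_atTop.const_mul_atTop (by positivity)

theorem edgeProportion_succ [Nonempty E₀] (hM : 0 < M)
    (hG : IsPerturbedBarabasiAlbert μ G₀ F G w k t) (n : ℕ) (ω : Ω) (l : Fin N) :
    (G (n + 1) ω).edgeProportion l = (G n ω).edgeProportion l +
      stepSize E₀ M n * (((fun a => (G n ω).edgeProportion a) ᵥ* F (n + 1)) l -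
        (G n ω).edgeProportion l) + stepSize E₀ M n * noise F G t l n ω := by
  have h1 : (M : ℝ) ≠ 0 := by positivity
  have hE : (0 : ℝ) < Fintype.card E₀ := by exact_mod_cast Fintype.card_pos
  have h2 : (Fintype.card E₀ : ℝ) + n * M ≠ 0 := by positivity
  have h3 : (Fintype.card E₀ : ℝ) + (n + 1) * M ≠ 0 := by positivity
  have h4 : ∀ q : ℝ, (G n ω).edgeProportion l + stepSize E₀ M n * (q - (G n ω).edgeProportion l) +
      stepSize E₀ M n * ((Finset.card {i | t n ω i = l} : ℝ) / M - q) =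
        (G (n + 1) ω).edgeProportion l := fun q => by
    unfold TypedMultigraph.edgeProportion stepSize
    rw [hG.card_edgesOfType_succ, card_edgeAt, card_edgeAt]
    push_cast
    field_simp
    ring
  exact (h4 _).symm

omit mΩ [Fintype V₀] in
theorem abs_noise_le [Nonempty E₀] (hF : ∀ n, 1 ≤ n → F n ∈ rowStochastic ℝ (Fin N))
    (l : Fin N) (n : ℕ) (ω : Ω) : |noise F G t l n ω| ≤ 1 := by
  have h1 : (Finset.card {i | t n ω i = l} : ℝ) / M ≤ 1 :=
    div_le_one_of_le₀ (by exact_mod_cast (Finset.card_le_univ _).trans_eq (Fintype.card_fin M))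
      (by positivity)
  have h2 : (0 : ℝ) ≤ (Finset.card {i | t n ω i = l} : ℝ) / M := by positivity
  have := nonempty_edgeAt E₀ M n
  obtain ⟨h3, h4⟩ := (G n ω).vecMul_edgeProportion_mem_Icc (hF (n + 1) (by omega)) l
  unfold noise
  exact abs_le.2 ⟨by linarith, by linarith⟩

theorem stronglyMeasurable_noise (hG : IsPerturbedBarabasiAlbert μ G₀ F G w k t) (l : Fin N)
    (n : ℕ) : StronglyMeasurable[hG.filtration (n + 1)] (noise F G t l n) := by
  -- The new edges of type `l` are counted by comparing two consecutive graphs.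
  have h : noise F G t l n = fun ω => (((G (n + 1) ω).edgesOfType l).card : ℝ) / M -
      ((((G n ω).edgesOfType l).card : ℝ) / M +
        ((fun a => (G n ω).edgeProportion a) ᵥ* F (n + 1)) l) := by
    ext ω
    rw [hG.card_edgesOfType_succ, noise]
    push_cast
    ring
  rw [h]
  exact (hG.stronglyMeasurable_comp le_rfl fun H => ((H.edgesOfType l).card : ℝ) / M).sub
    (hG.stronglyMeasurable_comp n.le_succ fun H => ((H.edgesOfType l).card : ℝ) / M +
      ((fun a => H.edgeProportion a) ᵥ* F (n + 1)) l)

theorem condExp_noise [IsProbabilityMeasure μ] [Nonempty E₀] (hM : 0 < M)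
    (hG : IsPerturbedBarabasiAlbert μ G₀ F G w k t)
    (hF : ∀ n, 1 ≤ n → F n ∈ rowStochastic ℝ (Fin N)) (l : Fin N) (n : ℕ) :
    μ[noise F G t l n | hG.filtration n] =ᵐ[μ] 0 := by
  have hM' : (M : ℝ) ≠ 0 := by positivity
  set c : Ω → ℝ := fun ω => (Finset.card {i | t n ω i = l} : ℝ) with hc
  set p : Ω → ℝ := fun ω => ((fun a => (G n ω).edgeProportion a) ᵥ* F (n + 1)) l with hp
  have hpm : StronglyMeasurable[hG.filtration n] p := hG.stronglyMeasurable_comp le_rfl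
    fun H => ((fun a => H.edgeProportion a) ᵥ* F (n + 1)) l
  have hni : Integrable (noise F G t l n) μ :=
    .of_bound ((stronglyMeasurable_noise hG l n).mono (hG.filtration.le _)).aestronglyMeasurable 1
      (ae_of_all _ (abs_noise_le hF l n))
  have hpi : Integrable p μ :=
    .of_bound (hpm.mono (hG.filtration.le _)).aestronglyMeasurable 1 (ae_of_all _ fun ω => by
      have := nonempty_edgeAt E₀ M n
      obtain ⟨h1, h2⟩ := (G n ω).vecMul_edgeProportion_mem_Icc (hF (n + 1) (by omega)) l
      rwa [Real.norm_of_nonneg h1])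
  have hnoise : noise F G t l n = (M : ℝ)⁻¹ • c - p := by
    ext ω
    simp [noise, hc, hp, inv_mul_eq_div]
  have hci : Integrable ((M : ℝ)⁻¹ • c) μ := by
    simpa [hnoise] using hni.add hpi
  rw [hnoise]
  filter_upwards [condExp_sub hci hpi (hG.filtration n),
    condExp_smul (μ := μ) (M : ℝ)⁻¹ c (hG.filtration n), hG.condExp_card_newEdges hF n l]
    with ω h1 h2 h3
  rw [h1, Pi.sub_apply, h2, Pi.smul_apply, h3,
    condExp_of_stronglyMeasurable (hG.filtration.le n) hpm hpi, smul_eq_mul,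
    inv_mul_cancel_left₀ hM']
  simp [hp]

/-- The edge proportions converge almost surely to the stationary distribution of the limiting
error matrix. -/
theorem ae_tendsto_edgeProportion [IsProbabilityMeasure μ] [Nonempty E₀] [NeZero N] (hM : 0 < M)
    (hG : IsPerturbedBarabasiAlbert μ G₀ F G w k t)
    (hF : ∀ n, 1 ≤ n → F n ∈ rowStochastic ℝ (Fin N)) {A : Matrix (Fin N) (Fin N) ℝ}
    (hA : A ∈ rowStochastic ℝ (Fin N)) (hpos : ∀ a b, 0 < A a b)
    (hlim : ∀ a b, Tendsto (fun n => F n a b) atTop (𝓝 (A a b)))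
    {ψ : Fin N → ℝ} (hψ : ψ ᵥ* A = ψ) (hψ1 : ∑ l, ψ l = 1) :
    ∀ᵐ ω ∂μ, ∀ l, Tendsto (fun n => (G n ω).edgeProportion l) atTop (𝓝 (ψ l)) := by
  have hS : ∀ᵐ ω ∂μ, ∀ l, ∃ s, Tendsto
      (fun n => ∑ j ∈ Finset.range n, stepSize E₀ M j * noise F G t l j ω) atTop (𝓝 s) :=
    ae_all_iff.2 fun l => ae_exists_tendsto_sum_of_martingaleDiff hG.filtration
      (stronglyMeasurable_noise hG l) (abs_noise_le hF l) (condExp_noise hM hG hF l)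
      (summable_stepSize_sq hM)
  filter_upwards [hS] with ω hω l
  refine tendsto_stationary_of_recursion (Fs := fun n => F (n + 1)) hA hpos
    (fun a b => (tendsto_add_atTop_iff_nat 1).2 (hlim a b)) (fun n => hF _ (by omega)) hψ hψ1
    (x := fun n l => (G n ω).edgeProportion l)
    (S := fun n l => ∑ j ∈ Finset.range n, stepSize E₀ M j * noise F G t l j ω)
    (fun n l => (G n ω).edgeProportion_nonneg l)
    (fun n => have := nonempty_edgeAt E₀ M n; (G n ω).sum_edgeProportion)
    (stepSize_nonneg (E₀ := E₀) (M := M)) (fun n => (stepSize_le hM n).trans ?_)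
    (tendsto_sum_stepSize hM) (fun l => by simp) (fun n l => ?_) hω l
  · exact div_le_one_of_le₀ (by linarith [n.cast_nonneg (α := ℝ)]) (by positivity)
  · rw [Finset.sum_range_succ, add_sub_cancel_left]
    exact edgeProportion_succ hM hG n ω l

end IsPerturbedBarabasiAlbert

/-! ### Convergence of the edge proportions -/

theorem mainTheorem3 {Ω : Type*} [MeasurableSpace Ω] (μ : Measure Ω) [IsProbabilityMeasure μ]
    (N M : ℕ) (hN : 0 < N) (hM : 0 < M)
    {V₀ E₀ : Type*} [Fintype V₀] [Fintype E₀] (G₀ : TypedMultigraph N V₀ E₀)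
    (hG₀ : ∀ l, 0 < (G₀.edgesOfType l).card)
    (Fseq : ℕ → Matrix (Fin N) (Fin N) ℝ) (F : Matrix (Fin N) (Fin N) ℝ)
    (hFseq : ∀ n, 1 ≤ n → Fseq n ∈ rowStochastic ℝ (Fin N))
    (hF : F ∈ rowStochastic ℝ (Fin N))
    (hlim : ∀ k l, Tendsto (fun n => Fseq n k l) atTop (𝓝 (F k l)))
    (hF01 : ∀ k l, F k l ∈ Set.Ioo (0 : ℝ) 1)
    (G : (n : ℕ) → Ω → TypedMultigraph N (VertexAt V₀ n) (EdgeAt E₀ M n))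
    (w : (n : ℕ) → Ω → Fin M → VertexAt V₀ n) (k t : ℕ → Ω → Fin M → Fin N)
    (hG : IsPerturbedBarabasiAlbert μ G₀ Fseq G w k t) :
    IsPerronEigenvalue F 1 ∧
    ∃ ψ : Fin N → ℝ,
      (∀ l, ψ l ∈ Set.Ioo (0 : ℝ) 1) ∧
      (∀ l, ∀ᵐ ω ∂μ, Tendsto (fun n => (G n ω).edgeProportion l) atTop (𝓝 (ψ l))) ∧
      (ψ ᵥ* F = ψ ∧ ∑ l, ψ l = 1 ∧ ∀ v : Fin N → ℝ, v ᵥ* F = v → ∑ l, v l = 1 → v = ψ) ∧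
      (F.IsSymm → F ∈ doublyStochastic ℝ (Fin N) ∧ ∀ l, ψ l = 1 / (N : ℝ)) := by
  have : NeZero N := ⟨hN.ne'⟩
  have hpos : ∀ k l, 0 < F k l := fun k l => (hF01 k l).1
  have hE : Nonempty E₀ := by
    obtain ⟨e, -⟩ := Finset.card_pos.1 (hG₀ 0)
    exact ⟨e⟩
  obtain ⟨ψ, hψpos, hψ, hψ1⟩ := exists_stationary hF hpos
  have huniq : ∀ v : Fin N → ℝ, v ᵥ* F = v → ∑ l, v l = 1 → v = ψ := fun v hv hv1 =>
    eq_of_vecMul_eq_self hF hpos hv hψ (hv1.trans hψ1.symm)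
  refine ⟨⟨?_, fun z hz hz1 => ?_⟩, ψ, fun l => ⟨hψpos l, ?_⟩, ?_, ⟨hψ, hψ1, huniq⟩,
    fun hsymm => ?_⟩
  · rw [Complex.ofReal_one]
    exact one_mem_spectrum_of_mem_rowStochastic (𝕜 := ℂ) hF
  · exact norm_lt_one_of_mem_spectrum (𝕜 := ℂ) hF hpos hz (by simpa using hz1)
  · calc ψ l = ∑ k, ψ k * F k l := (congrFun hψ l).symm
      _ < ∑ k, ψ k := Finset.sum_lt_sum_of_nonempty Finset.univ_nonempty fun k _ =>
          mul_lt_of_lt_one_right (hψpos k) (hF01 k l).2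
      _ = 1 := hψ1
  · exact ae_all_iff.1 (hG.ae_tendsto_edgeProportion hM hFseq hF hpos hlim hψ hψ1)
  · have hcol : ∀ l, ∑ k, F k l = 1 := fun l => by
      rw [← sum_row_of_mem_rowStochastic hF l]
      exact Finset.sum_congr rfl fun k _ => hsymm.apply l k
    refine ⟨mem_doublyStochastic_iff_sum.2 ⟨fun i j => (hpos i j).le,
      sum_row_of_mem_rowStochastic hF, hcol⟩, fun l => ?_⟩
    rw [← huniq (fun _ => 1 / (N : ℝ)) ?_ (by simp)]
    ext l
    simp [vecMul, dotProduct, ← Finset.mul_sum, hcol]
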